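/- Let $d\ge 1$ and $r_1,\dots,r_d\ge 1$ be integers, and let $\mathcal X=\{1,\dots,r_1\}\times\cdots\times\{1,\dots,r_d\}$ carry the coordinatewise partial order $\preceq$. A function $f:\mathcal X\to\mathbb R$ is $d$-monotone (isotonic) if $\bm x\preceq\bm x'$ implies $f(\bm x)\le f(\bm x')$. For a finite pre-ordered set $S$, weights $\bm w\in[0,\infty)^{S}$ and $\theta:S\to\mathbb R$, an isotonic regression of $\theta$ over $S$ with weights $\bm w$ is a minimiser of $\sum_{x\in S}(f(x)-\theta(x))^2w_x$ over all isotonic $f:S\to\mathbb R$; it is unique if all $w_x>0$. Let $\mathring g:\mathcal X\to\mathbb R$ be $d$-monotone, let $\bm x_1,\bm x_2,\dots\in\mathcal X$ be deterministic design points, and let $Y_i=\mathring g(\bm x_i)+\varepsilon_i$, where $\varepsilon_1,\varepsilon_2,\dots$ are independent and identically distributed with $\mathbb E[\varepsilon_i]=0$ and $\mathrm{Var}[\varepsilon_i]=\sigma^2<\infty$. Put $$w^{(n)}_{\bm x}=\frac1n\sum_{i=1}^n 1\{\bm x_i=\bm x\},\qquad \hat g_n(\bm x)=\frac{\sum_{i=1}^nY_i1\{\bm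 x_i=\bm x\}}{\sum_{i=1}^n1\{\bm x_i=\bm x\}}$$ (with $\hat g_n(\bm x)=0$, say, if $\bm x$ has not been observed; such a point has weight $0$), and let $\hat g^*_n$ be the $d$-monotone least squares estimator, that is, a (measurable) isotonic regression of $\hat g_n$ over $\mathcal X$ with weights $\bm w^{(n)}$. Assume that $\bm w^{(n)}\to\bm w$ as $n\to\infty$, where $w_{\bm x}>0$ for every $\bm x\in\mathcal X$. Partition each level set of $\mathring g$ into the connected components of its comparability graph (in which two points are joined if they are comparable for $\preceq$); the components are the comparable level sets of $\mathring g$. For $\bm\theta\in\mathbb R^{\mathcal X}$ let $\varphi^{\bm w}(\bm\theta)\in\mathbb R^{\mathcal X}$ be the vector whose restriction to each comparable level set of $\mathring g$ is the isotonic regression over that set, with weights $\bm w$, of the restriction of $\bm\theta$ to it. Then, as $n\to\infty$, $$\sqrt n\,(\hat{\bm g}^*_n-\mathring{\bm g})\ \xrightarrow{d}\ \varphi^{\bm w}(\bm Y_{\bm 0,\Sigma}),$$ where $\bm Y_{\bm 0,\Sigma}$ is a Gaussian vector in $\mathbb R^{\mathcal X}$ with mean zero and diagonal covariance matrix $\Sigma$,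 $\Sigma_{\bm x\bm x}=\sigma^2/w_{\bm x}$. -/

import Mathlib

open MeasureTheory ProbabilityTheory Filter Topology

/-- The finite grid `{1, …, r₁} × ⋯ × {1, …, r_d}`, with the coordinatewise order
(the order that Lean finds on a product). A function on it is `d`-monotone iff it is `Monotone`. -/
abbrev Grid {d : ℕ} (r : Fin d → ℕ) : Type :=
  (j : Fin d) → ↥(Finset.Icc 1 (r j))

/-- `f` is an isotonic regression of `θ` over the finite pre-ordered set `X` with weights `w`:
a minimiser of `∑ (f x - θ x)² w x` among isotonic functions (on a finite set all functions
are bounded). -/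
def IsIsotonicRegression {X : Type*} [Preorder X] [Fintype X] (w θ f : X → ℝ) : Prop :=
  Monotone f ∧
    ∀ h : X → ℝ, Monotone h → ∑ x, (f x - θ x) ^ 2 * w x ≤ ∑ x, (h x - θ x) ^ 2 * w x

/-- The isotonic regression of `θ` with weights `w`; for positive weights there is exactly one. -/
noncomputable def isotonicRegression {X : Type*} [Preorder X] [Fintype X] (w θ : X → ℝ) : X → ℝ :=
  Classical.epsilon (IsIsotonicRegression w θ)

/-- The comparable level set of `g` that contains `x`: the connected component of `x` in the graph
on the level set `{y | g y = g x}` whose edges join comparable points. -/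
def comparableLevelSet {X : Type*} [Preorder X] (g : X → ℝ) (x : X) : Set X :=
  {y | Relation.ReflTransGen (fun a b => g a = g b ∧ (a ≤ b ∨ b ≤ a)) x y}

theorem mem_comparableLevelSet {X : Type*} [Preorder X] (g : X → ℝ) (x : X) :
    x ∈ comparableLevelSet g x :=
  Relation.ReflTransGen.refl

/-- The operator `φ^w` attached to `g`: on each comparable level set of `g` it is the isotonic
regression, with weights `w`, of the restriction of `θ` to that set. -/
noncomputable def levelwiseIsotonicRegression {X : Type*} [Preorder X] [Finite X]
    (g w θ : X → ℝ) : X → ℝ := fun x =>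
  letI : Fintype ↥(comparableLevelSet g x) := Fintype.ofFinite _
  isotonicRegression (X := ↥(comparableLevelSet g x)) (fun y => w y) (fun y => θ y)
    ⟨x, mem_comparableLevelSet g x⟩

/-- The proportion of the first `n` design points that are equal to `x`. -/
noncomputable def designWeight {X : Type*} [DecidableEq X] (design : ℕ → X) (n : ℕ) (x : X) : ℝ :=
  (∑ i ∈ Finset.range n, if design i = x then (1 : ℝ) else 0) / n

/-- The average of the responses among the first `n` observations whose design point is `x`. -/
noncomputable def cellMean {X : Type*} [DecidableEq X] (design : ℕ → X) (Y : ℕ → ℝ) (n : ℕ)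
    (x : X) : ℝ :=
  (∑ i ∈ Finset.range n, if design i = x then Y i else 0) /
    ∑ i ∈ Finset.range n, if design i = x then (1 : ℝ) else 0

/-! The estimator is a weighted projection onto the cone of isotonic functions. Near `g` only order
constraints inside level sets of `g` can bind: between levels there is a positive gap `δ`. So once
the fluctuations, of order `1/√n`, are below `δ/2`, the rescaled error is exactly the levelwise
regression of the rescaled cell errors (`IsIsotonicRegression.smul_sub_eq_levelwise`, by adding two
variational inequalities).

The levelwise regression is jointly continuous in weights and data
(`tendsto_levelwiseIsotonicRegression`), and the cell sums satisfy a central limit theorem with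
independent limits (`tendstoInDistribution_cellSum`). Continuous mapping gives the limit, and the
event where the exact identity may fail has probability tending to zero. -/

/-! ### Isotonic regression as a projection onto a closed convex cone. -/

section Projection

variable {X : Type*} [Preorder X] [Fintype X]

/-- An isotonic regression satisfies the variational inequality of a projection on a convex set. -/
theorem IsIsotonicRegression.sum_le_zero {w θ f : X → ℝ} (hf : IsIsotonicRegression w θ f)
    {h : X → ℝ} (hh : Monotone h) : ∑ x, w x * (θ x - f x) * (h x - f x) ≤ 0 := by
  set A := ∑ x, w x * (θ x - f x) * (h x - f x) with hA
  set B := ∑ x, (h x - f x) ^ 2 * w x with hB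
  have key : ∀ t : ℝ, 0 ≤ t → t ≤ 1 → 2 * t * A ≤ t ^ 2 * B := by
    intro t ht ht1
    have hm : Monotone (fun x => f x + t * (h x - f x)) := by
      intro x y hxy
      have h1 := mul_le_mul_of_nonneg_left (hf.1 hxy) (sub_nonneg.2 ht1)
      have h2 := mul_le_mul_of_nonneg_left (hh hxy) ht
      simp only
      linarith
    have h3 := hf.2 _ hm
    have h4 : ∑ x, (f x + t * (h x - f x) - θ x) ^ 2 * w x
        = ∑ x, (f x - θ x) ^ 2 * w x - 2 * t * A + t ^ 2 * B := by
      rw [hA, hB, Finset.mul_sum, Finset.mul_sum, ← Finset.sum_sub_distrib,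
        ← Finset.sum_add_distrib]
      exact Finset.sum_congr rfl fun x _ => by ring
    linarith
  by_contra! hpos
  -- `t = 1` gives `2A ≤ B`, so `A / B`, the minimiser of `t²B - 2tA`, is an admissible step.
  have hB1 := key 1 zero_le_one le_rfl
  have hBpos : 0 < B := by linarith
  have := key (A / B) (by positivity) ((div_le_one hBpos).2 (by linarith))
  have h5 : 2 * (A / B) * A ≤ (A / B) * A := by
    calc _ ≤ (A / B) ^ 2 * B := this
      _ = (A / B) * A := by field_simp
  nlinarith [mul_pos (div_pos hpos hBpos) hpos]

/-- For positive weights there is an isotonic regression. -/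
theorem exists_isIsotonicRegression {w : X → ℝ} (hw : ∀ x, 0 < w x) (θ : X → ℝ) :
    ∃ f, IsIsotonicRegression w θ f := by
  let S : (X → ℝ) → ℝ := fun f => ∑ x, (f x - θ x) ^ 2 * w x
  have hScont : Continuous S := by fun_prop
  have hclosed : IsClosed {f : X → ℝ | Monotone f} := by
    have : {f : X → ℝ | Monotone f} = ⋂ x, ⋂ y, ⋂ _ : x ≤ y, {f | f x ≤ f y} := by
      ext f; simp [Monotone]
    rw [this]
    exact isClosed_iInter fun x => isClosed_iInter fun y => isClosed_iInter fun _ =>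
      isClosed_le (continuous_apply x) (continuous_apply y)
  have hbdd : Bornology.IsBounded {f | S f ≤ S 0} := by
    have hsub : {f | S f ≤ S 0} ⊆
        Set.pi Set.univ fun x => Metric.closedBall (θ x) (√(S 0 / w x)) := by
      intro f hf x _
      have h1 : (f x - θ x) ^ 2 * w x ≤ S f :=
        Finset.single_le_sum (f := fun x => (f x - θ x) ^ 2 * w x)
          (fun y _ => mul_nonneg (sq_nonneg _) (hw y).le) (Finset.mem_univ x)
      rw [Metric.mem_closedBall, Real.dist_eq]
      exact Real.abs_le_sqrt ((le_div_iff₀ (hw x)).2 (h1.trans hf))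
    exact (Bornology.IsBounded.pi fun x => Metric.isBounded_closedBall).subset hsub
  have hcomp : IsCompact ({f | S f ≤ S 0} ∩ {f : X → ℝ | Monotone f}) :=
    Metric.isCompact_of_isClosed_isBounded
      ((isClosed_le hScont continuous_const).inter hclosed) (hbdd.subset Set.inter_subset_left)
  obtain ⟨f, hf, hmin⟩ := hcomp.exists_isMinOn ⟨0, le_refl (S 0), monotone_const⟩
    hScont.continuousOn
  refine ⟨f, hf.2, fun h hh => ?_⟩
  rcases le_total (S h) (S 0) with h0 | h0
  · exact hmin ⟨h0, hh⟩
  · exact (hf.1 : S f ≤ S 0).trans h0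

theorem isIsotonicRegression_isotonicRegression {w : X → ℝ} (hw : ∀ x, 0 < w x) (θ : X → ℝ) :
    IsIsotonicRegression w θ (isotonicRegression w θ) :=
  Classical.epsilon_spec (exists_isIsotonicRegression hw θ)

end Projection

/-! ### Regression on comparable level sets: continuity and the exact local identity. -/

section Levelwise

variable {X : Type*} [Preorder X]

/-- Belonging to the same comparable level set of `g`. -/
def comparableLevelSetoid (g : X → ℝ) : Setoid X where
  r x y := y ∈ comparableLevelSet g x
  iseqv :=
    { refl := mem_comparableLevelSet g
      symm := fun h => by
        have : Std.Symm (fun a b : X => g a = g b ∧ (a ≤ b ∨ b ≤ a)) :=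
          ⟨fun a b hab => ⟨hab.1.symm, hab.2.symm⟩⟩
        exact Relation.ReflTransGen.stdSymm.symm _ _ h
      trans := Relation.ReflTransGen.trans }

theorem comparableLevelSet_eq {g : X → ℝ} {x y : X} (h : y ∈ comparableLevelSet g x) :
    comparableLevelSet g y = comparableLevelSet g x := by
  ext z
  exact ⟨fun hz => (comparableLevelSetoid g).trans h hz,
    fun hz => (comparableLevelSetoid g).trans ((comparableLevelSetoid g).symm h) hz⟩

theorem eq_of_mem_comparableLevelSet {g : X → ℝ} {x y : X} (h : y ∈ comparableLevelSet g x) :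
    g y = g x := by
  induction h with
  | refl => rfl
  | tail _ hbc ih => rw [← hbc.1, ih]

variable [Fintype X]

/-- The definition takes a separate regression at each point; since components partition `X`, all
points of one component share the same one. -/
theorem levelwiseIsotonicRegression_eq (g w θ : X → ℝ) (x : X)
    [Fintype ↥(comparableLevelSet g x)] (y : ↥(comparableLevelSet g x)) :
    levelwiseIsotonicRegression g w θ y =
      isotonicRegression (X := ↥(comparableLevelSet g x)) (fun y => w y) (fun y => θ y) y := by
  -- The two components are only propositionally equal, so the domain is generalised before
  -- substituting.
  have key : ∀ (S T : Set X) (i : Fintype S) (j : Fintype T) (_ : S = T) (z : X) (hS : z ∈ S)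
      (hT : z ∈ T), @isotonicRegression S _ i (fun y => w y) (fun y => θ y) ⟨z, hS⟩ =
        @isotonicRegression T _ j (fun y => w y) (fun y => θ y) ⟨z, hT⟩ := by
    rintro S T i j rfl z hS hT
    rw [Subsingleton.elim i j]
  exact key _ _ _ _ (comparableLevelSet_eq y.2) _ _ _

theorem levelwiseIsotonicRegression_mono {g w : X → ℝ} (hw : ∀ x, 0 < w x) (θ : X → ℝ) {x y : X}
    (hg : g x = g y) (hxy : x ≤ y) :
    levelwiseIsotonicRegression g w θ x ≤ levelwiseIsotonicRegression g w θ y := by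
  classical
  let : Fintype ↥(comparableLevelSet g x) := Fintype.ofFinite _
  have hy : y ∈ comparableLevelSet g x := Relation.ReflTransGen.single ⟨hg, Or.inl hxy⟩
  have h := (isIsotonicRegression_isotonicRegression (X := ↥(comparableLevelSet g x))
    (w := fun y => w y) (fun y => hw y) (fun y => θ y)).1
    (show (⟨x, mem_comparableLevelSet g x⟩ : ↥(comparableLevelSet g x)) ≤ ⟨y, hy⟩ from hxy)
  rwa [← levelwiseIsotonicRegression_eq, ← levelwiseIsotonicRegression_eq] at h

/-- The variational inequality for `φ^w`, against functions that are isotonic on the level sets. -/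
theorem levelwiseIsotonicRegression_sum_le_zero {g w : X → ℝ} (hw : ∀ x, 0 < w x) (θ : X → ℝ)
    {k : X → ℝ} (hk : ∀ x y, g x = g y → x ≤ y → k x ≤ k y) :
    ∑ x, w x * (θ x - levelwiseIsotonicRegression g w θ x) *
      (k x - levelwiseIsotonicRegression g w θ x) ≤ 0 := by
  classical
  let := comparableLevelSetoid g
  let : Fintype (Quotient (comparableLevelSetoid g)) := Fintype.ofFinite _
  rw [← Finset.sum_fiberwise Finset.univ (Quotient.mk (comparableLevelSetoid g))]
  refine Finset.sum_nonpos fun q _ => ?_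
  induction q using Quotient.inductionOn with
  | h x =>
    let : Fintype ↥(comparableLevelSet g x) := Fintype.ofFinite _
    have hmem : ∀ y, y ∈ Finset.univ.filter
        (fun y => Quotient.mk (comparableLevelSetoid g) y = Quotient.mk _ x) ↔
        y ∈ comparableLevelSet g x := by
      intro y
      simp only [Finset.mem_filter, Finset.mem_univ, true_and]
      exact eq_comm.trans Quotient.eq
    rw [Finset.sum_subtype (p := fun y => y ∈ comparableLevelSet g x) _ hmem]
    have h := (isIsotonicRegression_isotonicRegression (X := ↥(comparableLevelSet g x))
      (w := fun y => w y) (fun y => hw y) (fun y => θ y)).sum_le_zero (h := fun y => k y)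
      (fun a b hab => hk a b (by
        rw [eq_of_mem_comparableLevelSet a.2, eq_of_mem_comparableLevelSet b.2]) hab)
    refine le_trans (le_of_eq (Finset.sum_congr rfl fun y _ => ?_)) h
    rw [levelwiseIsotonicRegression_eq]

/-- `φ^w(θ)` depends continuously on the weights and on `θ`, as long as the weights are positive. -/
theorem tendsto_levelwiseIsotonicRegression {ι : Type*} {l : Filter ι} {g w θ : X → ℝ}
    {u v : ι → X → ℝ} (hw : ∀ x, 0 < w x) (hu : ∀ i x, 0 < u i x) (huw : Tendsto u l (𝓝 w))
    (hv : Tendsto v l (𝓝 θ)) :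
    Tendsto (fun i => levelwiseIsotonicRegression g (u i) (v i)) l
      (𝓝 (levelwiseIsotonicRegression g w θ)) := by
  set f := levelwiseIsotonicRegression g w θ with hf
  -- Testing each regression against the other and adding gives `∑ (b D + u D²) ≤ 0`, where `D` is
  -- their difference and `b` the expression squared here. Completing the square yields `∑ u D² ≤ ∑
  -- b² / u`.
  let R : ι → ℝ := fun i => ∑ x, ((w x - u i x) * (θ x - f x) + u i x * (θ x - v i x)) ^ 2 / u i x
  have hu' := tendsto_pi_nhds.1 huw
  have hv' := tendsto_pi_nhds.1 hv
  have hR : Tendsto R l (𝓝 0) := by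
    have : Tendsto R l (𝓝 (∑ x, ((w x - w x) * (θ x - f x) + w x * (θ x - θ x)) ^ 2 / w x)) := by
      refine tendsto_finsetSum _ fun x _ => Tendsto.div ?_ (hu' x) (hw x).ne'
      exact ((((hu' x).const_sub _).mul_const _).add
        ((hu' x).mul ((hv' x).const_sub _))).pow 2
    simpa using this
  have hbound : ∀ i x, u i x * (levelwiseIsotonicRegression g (u i) (v i) x - f x) ^ 2 ≤ R i := by
    intro i x
    set f' := levelwiseIsotonicRegression g (u i) (v i) with hf'
    have h1 := levelwiseIsotonicRegression_sum_le_zero (g := g) hw θ (k := f')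
      (fun x y h h' => levelwiseIsotonicRegression_mono (hu i) _ h h')
    have h2 := levelwiseIsotonicRegression_sum_le_zero (g := g) (hu i) (v i) (k := f)
      (fun x y h h' => levelwiseIsotonicRegression_mono hw _ h h')
    rw [← hf] at h1
    rw [← hf'] at h2
    have h3 : ∑ x, u i x * (f' x - f x) ^ 2 ≤ R i := by
      have h4 : ∑ x, u i x * (f' x - f x) ^ 2 ≤
          R i + 2 * (∑ x, w x * (θ x - f x) * (f' x - f x) +
            ∑ x, u i x * (v i x - f' x) * (f x - f' x)) := by
        rw [← Finset.sum_add_distrib, Finset.mul_sum, ← Finset.sum_add_distrib]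
        refine Finset.sum_le_sum fun x _ => ?_
        have hux := hu i x
        set b := (w x - u i x) * (θ x - f x) + u i x * (θ x - v i x) with hb
        have h5 : b ^ 2 / u i x + 2 * (b * (f' x - f x)) + u i x * (f' x - f x) ^ 2 =
            (b + u i x * (f' x - f x)) ^ 2 / u i x := by
          field_simp
          ring
        have h6 : 0 ≤ (b + u i x * (f' x - f x)) ^ 2 / u i x := by positivity
        have h7 : w x * (θ x - f x) * (f' x - f x) + u i x * (v i x - f' x) * (f x - f' x) =
            b * (f' x - f x) + u i x * (f' x - f x) ^ 2 := by
          rw [hb]; ring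
        rw [h7]
        linarith
      linarith
    exact (Finset.single_le_sum (f := fun x => u i x * (f' x - f x) ^ 2)
      (fun y _ => mul_nonneg (hu i y).le (sq_nonneg _)) (Finset.mem_univ x)).trans h3
  refine tendsto_pi_nhds.2 fun x => ?_
  have hlim : Tendsto (fun i => √(R i / u i x)) l (𝓝 0) := by
    have := (hR.div (hu' x) (hw x).ne').sqrt
    simpa using this
  rw [tendsto_iff_norm_sub_tendsto_zero]
  refine squeeze_zero (fun _ => norm_nonneg _) (fun i => ?_) hlim
  refine Real.abs_le_sqrt ((le_div_iff₀ (hu i x)).2 ?_)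
  rw [mul_comm]
  exact hbound i x

/-- If the rescaled levelwise regression of the fluctuations is small compared with the gaps
of `g`, it is the rescaled fluctuation of the isotonic regression. -/
theorem IsIsotonicRegression.smul_sub_eq_levelwise {g u θ f W : X → ℝ} {s δ : ℝ}
    (hg : Monotone g) (hs : 0 < s) (hδ : ∀ x y, g x < g y → δ ≤ g y - g x) (hu : ∀ x, 0 < u x)
    (hθ : ∀ x, W x = s * (θ x - g x)) (hf : IsIsotonicRegression u θ f)
    (hsmall : ∀ x, |levelwiseIsotonicRegression g u W x| ≤ s * (δ / 2)) :
    s • (f - g) = levelwiseIsotonicRegression g u W := by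
  set F := levelwiseIsotonicRegression g u W with hF
  have hk : ∀ x y, g x = g y → x ≤ y → (s • (f - g)) x ≤ (s • (f - g)) y := by
    intro x y hxy hle
    simp only [Pi.smul_apply, Pi.sub_apply, smul_eq_mul]
    have := hf.1 hle
    exact mul_le_mul_of_nonneg_left (by linarith) hs.le
  -- Across levels the gap `δ` absorbs two perturbations of size at most `δ / 2`; within a level `F`
  -- is itself isotonic.
  have hm : Monotone (fun x => g x + F x / s) := by
    intro x y hxy
    rcases (hg hxy).eq_or_lt with h | h
    · have := levelwiseIsotonicRegression_mono hu W h hxy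
      rw [← hF] at this
      simp only [h]
      gcongr
    · have h1 := (div_le_iff₀' hs).2 ((le_abs_self _).trans (hsmall x))
      have h2 := (le_div_iff₀' hs).2 (show s * (-(δ / 2)) ≤ F y by
        linarith [(abs_le.1 (hsmall y)).1])
      have h3 := hδ x y h
      simp only
      linarith
  have h1 := hf.sum_le_zero hm
  have h2 := levelwiseIsotonicRegression_sum_le_zero hu W hk
  rw [← hF] at h2
  -- The two variational inequalities combine into a weighted squared distance, which must then
  -- vanish.
  have h3 : ∑ x, u x * ((s • (f - g)) x - F x) ^ 2 =
      s ^ 2 * (∑ x, u x * (θ x - f x) * (g x + F x / s - f x)) +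
        ∑ x, u x * (W x - F x) * ((s • (f - g)) x - F x) := by
    rw [Finset.mul_sum, ← Finset.sum_add_distrib]
    refine Finset.sum_congr rfl fun x _ => ?_
    rw [hθ]
    simp only [Pi.smul_apply, Pi.sub_apply, smul_eq_mul]
    field_simp
    ring
  have h4 : ∑ x, u x * ((s • (f - g)) x - F x) ^ 2 ≤ 0 := by
    rw [h3]
    exact add_nonpos (mul_nonpos_of_nonneg_of_nonpos (sq_nonneg s) h1) h2
  have h5 := (Finset.sum_eq_zero_iff_of_nonneg
    (fun x _ => mul_nonneg (hu x).le (sq_nonneg _))).1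
    (le_antisymm h4 (Finset.sum_nonneg fun x _ => mul_nonneg (hu x).le (sq_nonneg _)))
  ext x
  have h6 := h5 x (Finset.mem_univ x)
  have h7 := (mul_eq_zero.1 h6).resolve_left (hu x).ne'
  exact sub_eq_zero.1 (pow_eq_zero_iff two_ne_zero |>.1 h7)

end Levelwise

/-- A function on a finite type has a positive minimal gap between its values. -/
theorem exists_pos_forall_le_sub_of_lt {X : Type*} [Finite X] (g : X → ℝ) :
    ∃ δ > 0, ∀ x y, g x < g y → δ ≤ g y - g x := by
  rcases Set.eq_empty_or_nonempty {p : X × X | g p.1 < g p.2} with h | h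
  · exact ⟨1, one_pos, fun x y hxy => (Set.eq_empty_iff_forall_notMem.1 h (x, y) hxy).elim⟩
  · obtain ⟨p, hp, hmin⟩ := Set.exists_min_image _ (fun p : X × X => g p.2 - g p.1)
      (Set.toFinite _) h
    exact ⟨g p.2 - g p.1, sub_pos.2 hp, fun x y hxy => hmin (x, y) hxy⟩

/-! ### Central limit theorem for the cell sums, by characteristic functions. -/

section CentralLimit

variable {Ω : Type*} [MeasurableSpace Ω] {P : Measure Ω} [IsProbabilityMeasure P]
  {ε : ℕ → Ω → ℝ} {σ : ℝ}

theorem tendstoInMeasure_const_of_tendsto {E : Type*} [PseudoEMetricSpace E] {a : ℕ → E} {b : E}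
    (h : Tendsto a atTop (𝓝 b)) :
    TendstoInMeasure P (fun n (_ : Ω) => a n) atTop (fun _ => b) :=
  tendstoInMeasure_of_tendsto_ae (fun _ => aestronglyMeasurable_const) (ae_of_all _ fun _ => h)

/-- The central limit theorem for a number `N n ∼ c n` of summands, with the normalisation `√n`. -/
theorem tendsto_charFun_inv_sqrt_mul_pow_of_tendsto_div (hε_indep : iIndepFun ε P)
    (hε_ident : ∀ i, IdentDistrib (ε i) (ε 0) P P) (hε_memLp : MemLp (ε 0) 2 P)
    (hε_mean : ∫ ω, ε 0 ω ∂P = 0) (hε_var : variance (ε 0) P = σ ^ 2) {N : ℕ → ℕ} {c : ℝ}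
    (hc : 0 < c) (hN : Tendsto (fun n => (N n : ℝ) / n) atTop (𝓝 c)) (s : ℝ) :
    Tendsto (fun n : ℕ => charFun (P.map (ε 0)) ((√(n : ℝ))⁻¹ * s) ^ N n) atTop
      (𝓝 (Complex.exp (-(c * σ ^ 2 * s ^ 2 / 2) : ℝ))) := by
  have hmeas : ∀ n, AEMeasurable (ε n) P := fun n => (hε_ident n).aemeasurable_fst
  have hNtop : Tendsto N atTop atTop := by
    have h := hN.pos_mul_atTop hc tendsto_natCast_atTop_atTop
    refine tendsto_natCast_atTop_iff.1 (h.congr' ?_)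
    filter_upwards [eventually_ne_atTop 0] with n hn
    field_simp
  have hclt := tendstoInDistribution_inv_sqrt_mul_sum_sub (P := P) (X := ε)
    (P' := gaussianReal 0 Var[ε 0; P].toNNReal) (Y := id) HasLaw.id hε_memLp hε_indep hε_ident
  simp only [hε_mean, mul_zero, sub_zero, hε_var] at hclt
  -- The classical theorem along `N n`; Slutsky with the factor `√(N n / n) → √c` then changes the
  -- normalisation.
  have hcltN : TendstoInDistribution
      (fun n ω => (√(N n : ℝ))⁻¹ * ∑ k ∈ Finset.range (N n), ε k ω) atTop id (fun _ => P)
      (gaussianReal 0 (σ ^ 2).toNNReal) :=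
    ⟨fun n => hclt.forall_aemeasurable (N n), hclt.aemeasurable_limit, hclt.tendsto.comp hNtop⟩
  have hscaled := hcltN.continuous_comp_prodMk_of_tendstoInMeasure_const
    (g := fun p : ℝ × ℝ => p.2 * p.1) (by fun_prop)
    (tendstoInMeasure_const_of_tendsto hN.sqrt) (fun _ => aemeasurable_const)
  have hlim := ProbabilityMeasure.tendsto_iff_tendsto_charFun.1 hscaled.tendsto s
  simp only [ProbabilityMeasure.coe_mk, id] at hlim
  have hgauss : charFun ((gaussianReal 0 (σ ^ 2).toNNReal).map fun x => √c * x) s =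
      Complex.exp (-(c * σ ^ 2 * s ^ 2 / 2) : ℝ) := by
    rw [charFun_map_mul, charFun_gaussianReal, Real.coe_toNNReal _ (sq_nonneg σ)]
    congr 1
    rw [show (c : ℝ) * σ ^ 2 * s ^ 2 / 2 = σ ^ 2 * (√c * s) ^ 2 / 2 by
      rw [mul_pow, Real.sq_sqrt hc.le]; ring]
    push_cast
    ring
  rw [hgauss] at hlim
  refine hlim.congr' ?_
  filter_upwards [hNtop.eventually_ne_atTop 0] with n hn
  rw [charFun_map_mul_comp ((Finset.aemeasurable_fun_sum _ fun k _ => hmeas k).const_mul _),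
    charFun_inv_sqrt_mul_sum hε_indep hε_ident, Real.sqrt_div (Nat.cast_nonneg _)]
  have : √(N n : ℝ) ≠ 0 := Real.sqrt_ne_zero'.2 (by positivity)
  congr 2
  field_simp

theorem designWeight_eq_card_div {X : Type*} [DecidableEq X] (design : ℕ → X) (n : ℕ) (x : X) :
    designWeight design n x = (Finset.card {i ∈ Finset.range n | design i = x} : ℝ) / n := by
  simp [designWeight]

variable {X : Type*} [Fintype X] [DecidableEq X]

/-- Each error enters exactly one cell, so a linear functional of the cell sums is one weighted sum
of independent errors; grouping factors by cell gives the powers. -/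
theorem charFun_map_cellSum {P : Measure Ω} (hε_indep : iIndepFun ε P)
    (hε_ident : ∀ i, IdentDistrib (ε i) (ε 0) P P) (design : ℕ → X) (n : ℕ) (b : X → ℝ)
    (t : EuclideanSpace ℝ X) :
    charFun (P.map fun ω => WithLp.toLp 2
        fun x => b x * ∑ i ∈ Finset.range n, if design i = x then ε i ω else 0) t =
      ∏ x, charFun (P.map (ε 0)) (b x * t x) ^
        (Finset.card {i ∈ Finset.range n | design i = x}) := by
  have hmeas : ∀ n, AEMeasurable (ε n) P := fun n => (hε_ident n).aemeasurable_fst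
  let a : ℕ → ℝ := fun i => b (design i) * t (design i)
  have hmeasV : AEMeasurable (fun ω => WithLp.toLp 2
      fun x => b x * ∑ i ∈ Finset.range n, if design i = x then ε i ω else 0) P := by
    refine (WithLp.measurable_toLp 2 (X → ℝ)).comp_aemeasurable (aemeasurable_pi_lambda _ fun x =>
      (Finset.aemeasurable_fun_sum _ fun i _ => ?_).const_mul _)
    split_ifs
    exacts [hmeas i, aemeasurable_const]
  have hmeasS : AEMeasurable (fun ω => ∑ i ∈ Finset.range n, a i * ε i ω) P :=
    Finset.aemeasurable_fun_sum _ fun i _ => (hmeas i).const_mul _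
  have hlin : charFun (P.map fun ω => WithLp.toLp 2
        fun x => b x * ∑ i ∈ Finset.range n, if design i = x then ε i ω else 0) t =
      charFun (P.map fun ω => ∑ i ∈ Finset.range n, a i * ε i ω) 1 := by
    rw [charFun_apply, charFun_apply, integral_map hmeasV (by fun_prop),
      integral_map hmeasS (by fun_prop)]
    refine integral_congr_ae (ae_of_all _ fun ω => ?_)
    have : inner ℝ (WithLp.toLp 2
        fun x => b x * ∑ i ∈ Finset.range n, if design i = x then ε i ω else 0) t =
        ∑ i ∈ Finset.range n, a i * ε i ω := by
      simp only [PiLp.inner_apply, RCLike.inner_apply, conj_trivial, Finset.mul_sum]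
      rw [Finset.sum_comm]
      refine Finset.sum_congr rfl fun i _ => ?_
      rw [Finset.sum_eq_single (design i)]
      · simp only [if_true, a]; ring
      · intro x _ hx
        simp [hx.symm]
      · simp
    simp [this]
  rw [hlin, (iIndepFun.precomp Subtype.val_injective (hε_indep.comp (fun i x => a i * x)
    (fun i => by fun_prop))).charFun_map_fun_finsetSum_eq_prod
    (fun i _ => (hmeas i).const_mul (a i)), Finset.prod_apply,
    ← Finset.prod_fiberwise (Finset.range n) design]
  refine Finset.prod_congr rfl fun x _ => ?_
  rw [← Finset.prod_const]
  refine Finset.prod_congr rfl fun i hi => ?_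
  rw [charFun_map_mul_comp (hmeas i), (hε_ident i).map_eq]
  simp [a, (Finset.mem_filter.1 hi).2]

/-- The central limit theorem for the normalised sums of the errors in the cells. -/
theorem tendstoInDistribution_cellSum {Ω' : Type*} [MeasurableSpace Ω'] {P' : Measure Ω'}
    [IsProbabilityMeasure P'] (hε_indep : iIndepFun ε P)
    (hε_ident : ∀ i, IdentDistrib (ε i) (ε 0) P P) (hε_memLp : MemLp (ε 0) 2 P)
    (hε_mean : ∫ ω, ε 0 ω ∂P = 0) (hε_var : variance (ε 0) P = σ ^ 2)
    {design : ℕ → X} {w : X → ℝ} (hw_pos : ∀ x, 0 < w x)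
    (hw : Tendsto (fun n => designWeight design n) atTop (𝓝 w))
    {Z : Ω' → X → ℝ} (hZ : HasGaussianLaw Z P') (hZ_mean : ∀ x, ∫ ω', Z ω' x ∂P' = 0)
    (hZ_cov : ∀ x y, covariance (fun ω' => Z ω' x) (fun ω' => Z ω' y) P' =
      if x = y then σ ^ 2 / w x else 0) :
    TendstoInDistribution (fun (n : ℕ) ω x =>
      (√(n : ℝ))⁻¹ / w x * ∑ i ∈ Finset.range n, if design i = x then ε i ω else 0) atTop
      Z (fun _ => P) P' := by
  have hmeas : ∀ n, AEMeasurable (ε n) P := fun n => (hε_ident n).aemeasurable_fst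
  have hmeasV : ∀ n : ℕ, AEMeasurable (fun ω x => (√(n : ℝ))⁻¹ / w x *
      ∑ i ∈ Finset.range n, if design i = x then ε i ω else 0) P := by
    refine fun n => aemeasurable_pi_lambda _ fun x =>
      (Finset.aemeasurable_fun_sum _ fun i _ => ?_).const_mul _
    split_ifs
    exacts [hmeas i, aemeasurable_const]
  -- Characteristic functions need an inner product, hence the passage through `EuclideanSpace`.
  have hlp : TendstoInDistribution (fun (n : ℕ) ω => WithLp.toLp 2 fun x =>
      (√(n : ℝ))⁻¹ / w x * ∑ i ∈ Finset.range n, if design i = x then ε i ω else 0) atTop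
      (fun ω' => WithLp.toLp 2 (Z ω')) (fun _ => P) P' := by
    refine ⟨fun n => (WithLp.measurable_toLp 2 (X → ℝ)).comp_aemeasurable (hmeasV n),
      (WithLp.measurable_toLp 2 (X → ℝ)).comp_aemeasurable hZ.aemeasurable, ?_⟩
    refine ProbabilityMeasure.tendsto_iff_tendsto_charFun.2 fun t => ?_
    simp only [ProbabilityMeasure.coe_mk]
    have hlaw : charFun (P'.map fun ω' => WithLp.toLp 2 (Z ω')) t =
        ∏ x, Complex.exp (-(w x * σ ^ 2 * (t x / w x) ^ 2 / 2) : ℝ) := by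
      have hcoord : ∀ x, HasGaussianLaw (fun ω' => Z ω' x) P' := fun x => hZ.eval x
      have hmul : ∀ x, MemLp (fun ω' => Z ω' x * t x) 2 P' := fun x =>
        (hcoord x).memLp_two.mul_const _
      rw [(hZ.toLp_pi 2).charFun_map_eq]
      have hinner : (fun ω' => inner ℝ t (WithLp.toLp 2 fun x => Z ω' x)) =
          fun ω' => ∑ x, Z ω' x * t x := by
        ext ω'
        simp [PiLp.inner_apply]
      rw [hinner, variance_fun_sum hmul, integral_finsetSum _ fun x _ =>
        (hmul x).integrable one_le_two]
      simp only [integral_mul_const, hZ_mean, zero_mul, Finset.sum_const_zero,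
        Complex.ofReal_zero, zero_sub, covariance_mul_const_left, covariance_mul_const_right,
        hZ_cov, ite_mul, Finset.sum_ite_eq, Finset.mem_univ, if_true]
      rw [← Complex.exp_sum]
      congr 1
      push_cast
      rw [Finset.sum_div, ← Finset.sum_neg_distrib]
      refine Finset.sum_congr rfl fun x _ => ?_
      have : (w x : ℂ) ≠ 0 := Complex.ofReal_ne_zero.2 (hw_pos x).ne'
      field_simp
    rw [hlaw]
    simp only [charFun_map_cellSum hε_indep hε_ident design]
    refine tendsto_finsetProd _ fun x _ => ?_
    have h := tendsto_charFun_inv_sqrt_mul_pow_of_tendsto_div hε_indep hε_ident hε_memLp hε_mean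
      hε_var (hw_pos x) ((tendsto_pi_nhds.1 hw x).congr fun n =>
        designWeight_eq_card_div design n x) (t x / w x)
    refine h.congr fun n => ?_
    congr 2
    ring
  exact hlp.continuous_comp (g := fun v : EuclideanSpace ℝ X => WithLp.ofLp v) (by fun_prop)

end CentralLimit

/-- A sequence that converges in distribution vanishes in probability after multiplication by
constants that tend to `0`. -/
theorem MeasureTheory.TendstoInDistribution.tendsto_measure_le_norm_smul
    {Ω Ω' E : Type*} [MeasurableSpace Ω] {P : Measure Ω} [IsProbabilityMeasure P]
    [MeasurableSpace Ω'] {P' : Measure Ω'} [IsProbabilityMeasure P']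
    [NormedAddCommGroup E] [NormedSpace ℝ E] [SecondCountableTopology E] [MeasurableSpace E]
    [BorelSpace E] {V : ℕ → Ω → E} {Z : Ω' → E}
    (h : TendstoInDistribution V atTop Z (fun _ => P) P') {a : ℕ → ℝ}
    (ha : Tendsto a atTop (𝓝 0)) {c : ℝ} (hc : 0 < c) :
    Tendsto (fun n => P {ω | c ≤ ‖a n • V n ω‖}) atTop (𝓝 0) := by
  have hsmul := h.continuous_comp_prodMk_of_tendstoInMeasure_const
    (g := fun p : E × ℝ => p.2 • p.1) (by fun_prop)
    (tendstoInMeasure_const_of_tendsto ha) (fun _ => aemeasurable_const)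
  have hclosed : IsClosed {v : E | c ≤ ‖v‖} := isClosed_le continuous_const continuous_norm
  -- Portmanteau for a closed set that the limit law, a point mass at `0`, does not charge.
  have hlim := ProbabilityMeasure.limsup_measure_closed_le_of_tendsto hsmul.tendsto hclosed
  simp only [ProbabilityMeasure.coe_mk, zero_smul] at hlim
  rw [Measure.map_apply_of_aemeasurable aemeasurable_const hclosed.measurableSet] at hlim
  simp only [Set.preimage_ofPred_eq, norm_zero, not_le.2 hc, Set.ofPred_false, measure_empty,
    nonpos_iff_eq_zero] at hlim
  refine tendsto_of_le_liminf_of_limsup_le bot_le ?_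
  rw [← hlim]
  refine le_of_eq (limsup_congr (Eventually.of_forall fun n => ?_))
  exact (Measure.map_apply_of_aemeasurable (hsmul.forall_aemeasurable n)
    hclosed.measurableSet).symm

/-! ### Transfer of the limit to the estimator. -/

section Main

variable {X : Type*} [Preorder X] [Fintype X]

/-- `φ` of the rescaled vector `v * w / u`, with the weights `u` bounded below by `w / 2`. -/
noncomputable def truncatedLevelwiseRegression (g w : X → ℝ) (p : (X → ℝ) × (X → ℝ)) : X → ℝ :=
  levelwiseIsotonicRegression g (fun x => max (p.2 x) (w x / 2))
    (fun x => p.1 x * w x / max (p.2 x) (w x / 2))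

/-- Design weights may vanish for small `n`; truncation keeps them positive, so the map is
continuous everywhere and continuous mapping applies. -/
theorem continuous_truncatedLevelwiseRegression {g w : X → ℝ} (hw : ∀ x, 0 < w x) :
    Continuous (truncatedLevelwiseRegression g w) := by
  have hpos : ∀ (p : (X → ℝ) × (X → ℝ)) x, 0 < max (p.2 x) (w x / 2) := fun p x =>
    lt_max_of_lt_right (half_pos (hw x))
  have hu : Continuous fun (p : (X → ℝ) × (X → ℝ)) x => max (p.2 x) (w x / 2) := by fun_prop
  have hv : Continuous fun (p : (X → ℝ) × (X → ℝ)) x => p.1 x * w x / max (p.2 x) (w x / 2) :=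
    continuous_pi fun x => Continuous.div (by fun_prop) (by fun_prop) fun p => (hpos p x).ne'
  exact continuous_iff_continuousAt.2 fun p =>
    tendsto_levelwiseIsotonicRegression (hpos p) hpos hu.continuousAt hv.continuousAt

theorem truncatedLevelwiseRegression_apply (g : X → ℝ) {w : X → ℝ} (v : X → ℝ)
    {u : X → ℝ} (hu : ∀ x, w x / 2 ≤ u x) :
    truncatedLevelwiseRegression g w (v, u) =
      levelwiseIsotonicRegression g u (fun x => v x * w x / u x) := by
  simp only [truncatedLevelwiseRegression, max_eq_left (hu _)]

variable [DecidableEq X]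

/-- The rescaled cell means are the normalised sums of the errors, divided by the weights. -/
theorem cellSum_mul_div_designWeight {X : Type*} [DecidableEq X] {design : ℕ → X} {n : ℕ} {x : X} {g w : X → ℝ}
    {e y : ℕ → ℝ} (hy : ∀ i, y i = g (design i) + e i) (hwx : w x ≠ 0)
    (hn : designWeight design n x ≠ 0) :
    (√(n : ℝ))⁻¹ / w x * (∑ i ∈ Finset.range n, if design i = x then e i else 0) * w x /
      designWeight design n x = √(n : ℝ) * (cellMean design y n x - g x) := by
  have hsum : (∑ i ∈ Finset.range n, if design i = x then y i else 0) =
      g x * (∑ i ∈ Finset.range n, if design i = x then (1 : ℝ) else 0) +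
        ∑ i ∈ Finset.range n, if design i = x then e i else 0 := by
    rw [Finset.mul_sum, ← Finset.sum_add_distrib]
    refine Finset.sum_congr rfl fun i _ => ?_
    split_ifs with h
    · rw [hy, h, mul_one]
    · simp
  unfold designWeight at hn ⊢
  rw [cellMean, hsum]
  obtain ⟨hN, hn0⟩ := div_ne_zero_iff.1 hn
  have hsqrt : √(n : ℝ) ≠ 0 := Real.sqrt_ne_zero'.2 (lt_of_le_of_ne (Nat.cast_nonneg n) hn0.symm)
  have hsq : √(n : ℝ) ^ 2 = n := Real.sq_sqrt (Nat.cast_nonneg n)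
  field_simp
  rw [hsq]
  ring

/-- The limit distribution of the isotonic least squares estimator over a finite preorder. -/
theorem tendstoInDistribution_isotonicRegression
    {Ω : Type*} [MeasurableSpace Ω] {P : Measure Ω} [IsProbabilityMeasure P]
    {Ω' : Type*} [MeasurableSpace Ω'] {P' : Measure Ω'} [IsProbabilityMeasure P']
    {g : X → ℝ} (hg : Monotone g) {design : ℕ → X} {w : X → ℝ} (hw_pos : ∀ x, 0 < w x)
    (hw : Tendsto (fun n => designWeight design n) atTop (𝓝 w))
    {ε : ℕ → Ω → ℝ} {Y : ℕ → Ω → ℝ} (hY : ∀ i ω, Y i ω = g (design i) + ε i ω)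
    {gStar : ℕ → Ω → X → ℝ} (hgStar_meas : ∀ n, AEMeasurable (gStar n) P)
    (hgStar : ∀ n, ∀ᵐ ω ∂P, IsIsotonicRegression (designWeight design n)
      (cellMean design (fun i => Y i ω) n) (gStar n ω))
    {Z : Ω' → X → ℝ}
    (hclt : TendstoInDistribution (fun (n : ℕ) ω x =>
      (√(n : ℝ))⁻¹ / w x * ∑ i ∈ Finset.range n, if design i = x then ε i ω else 0) atTop
      Z (fun _ => P) P') :
    TendstoInDistribution (fun (n : ℕ) (ω : Ω) => √(n : ℝ) • (gStar n ω - g)) atTop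
      (fun ω' => levelwiseIsotonicRegression g w (Z ω')) (fun _ => P) P' := by
  set V : ℕ → Ω → X → ℝ := fun n ω x =>
    (√(n : ℝ))⁻¹ / w x * ∑ i ∈ Finset.range n, if design i = x then ε i ω else 0 with hV
  set T : ℕ → Ω → X → ℝ := fun n ω =>
    truncatedLevelwiseRegression g w (V n ω, designWeight design n) with hT
  have hTlim : TendstoInDistribution T atTop
      (fun ω' => levelwiseIsotonicRegression g w (Z ω')) (fun _ => P) P' := by
    have h := hclt.continuous_comp_prodMk_of_tendstoInMeasure_const
      (continuous_truncatedLevelwiseRegression (g := g) hw_pos)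
      (tendstoInMeasure_const_of_tendsto hw) (fun _ => aemeasurable_const)
    have hlim : ∀ ω', truncatedLevelwiseRegression g w (Z ω', w) =
        levelwiseIsotonicRegression g w (Z ω') := fun ω' => by
      rw [truncatedLevelwiseRegression_apply g _ fun x => half_le_self (hw_pos x).le]
      simp only [mul_div_cancel_right₀ _ (hw_pos _).ne']
    simpa only [hlim] using h
  refine tendstoInDistribution_of_tendstoInMeasure_sub _ _ hTlim ?_
    fun n => ((hgStar_meas n).sub_const g).const_smul (√(n : ℝ))
  obtain ⟨δ, hδ, hgap⟩ := exists_pos_forall_le_sub_of_lt g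
  -- Off this vanishing event the fluctuations are below half the gap, so for large `n` the
  -- estimator's rescaled error equals `T n` almost surely there.
  have hsmall := hTlim.tendsto_measure_le_norm_smul
    (tendsto_inv_atTop_zero.comp (Real.tendsto_sqrt_atTop.comp tendsto_natCast_atTop_atTop))
    (half_pos hδ)
  rw [tendstoInMeasure_iff_norm]
  intro η hη
  refine tendsto_of_tendsto_of_tendsto_of_le_of_le' tendsto_const_nhds hsmall
    (Eventually.of_forall fun _ => bot_le) ?_
  have hweight : ∀ᶠ n in atTop, ∀ x, w x / 2 ≤ designWeight design n x :=
    eventually_all.2 fun x =>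
      (tendsto_pi_nhds.1 hw x).eventually_const_le (half_lt_self (hw_pos x))
  filter_upwards [hweight, eventually_gt_atTop 0] with n hn hn0
  refine measure_mono_ae ?_
  filter_upwards [hgStar n] with ω hω hle
  by_contra hlt
  have hs : 0 < √(n : ℝ) := Real.sqrt_pos.2 (Nat.cast_pos.2 hn0)
  have hu : ∀ x, 0 < designWeight design n x := fun x => (half_pos (hw_pos x)).trans_le (hn x)
  have hTeq : T n ω = levelwiseIsotonicRegression g (designWeight design n)
      (fun x => V n ω x * w x / designWeight design n x) :=
    truncatedLevelwiseRegression_apply g _ hn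
  have heq : √(n : ℝ) • (gStar n ω - g) = T n ω := by
    rw [hTeq]
    refine hω.smul_sub_eq_levelwise hg hs hgap hu (fun x =>
      cellSum_mul_div_designWeight (fun i => hY i ω) (hw_pos x).ne' (hu x).ne') fun x => ?_
    rw [← hTeq]
    have hnorm : ‖(√(n : ℝ))⁻¹ • T n ω‖ < δ / 2 := not_le.1 hlt
    have hx := (norm_le_pi_norm ((√(n : ℝ))⁻¹ • T n ω) x).trans hnorm.le
    rw [Pi.smul_apply, smul_eq_mul, norm_mul, norm_inv, Real.norm_of_nonneg hs.le,
      inv_mul_le_iff₀ hs] at hx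
    exact hx
  have hzero : η ≤ ‖√(n : ℝ) • (gStar n ω - g) - T n ω - 0‖ := hle
  rw [heq] at hzero
  simp only [sub_self, norm_zero] at hzero
  exact hη.not_ge hzero

end Main

theorem corollary5p1 {d : ℕ} (r : Fin d → ℕ)
    {Ω : Type*} [MeasurableSpace Ω] (P : Measure Ω) [IsProbabilityMeasure P]
    {Ω' : Type*} [MeasurableSpace Ω'] (P' : Measure Ω') [IsProbabilityMeasure P']
    -- the regression function, the design points and their limiting frequencies
    (g : Grid r → ℝ) (hg : Monotone g)
    (design : ℕ → Grid r) (w : Grid r → ℝ) (hw_pos : ∀ x, 0 < w x)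
    (hw : Tendsto (fun n => designWeight design n) atTop (𝓝 w))
    -- the errors and the responses
    (ε : ℕ → Ω → ℝ) (σ : ℝ)
    (hε_indep : iIndepFun ε P) (hε_ident : ∀ i j, IdentDistrib (ε i) (ε j) P P)
    (hε_memLp : ∀ i, MemLp (ε i) 2 P)
    (hε_mean : ∀ i, ∫ ω, ε i ω ∂P = 0) (hε_var : ∀ i, variance (ε i) P = σ ^ 2)
    (Y : ℕ → Ω → ℝ) (hY : ∀ i ω, Y i ω = g (design i) + ε i ω)
    -- the isotonic least squares estimator
    (gStar : ℕ → Ω → Grid r → ℝ) (hgStar_meas : ∀ n, AEMeasurable (gStar n) P)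
    (hgStar : ∀ n, ∀ᵐ ω ∂P, IsIsotonicRegression (designWeight design n)
      (cellMean design (fun i => Y i ω) n) (gStar n ω))
    -- the Gaussian vector with mean zero and diagonal covariance matrix
    (Z : Ω' → Grid r → ℝ) (hZ : HasGaussianLaw Z P')
    (hZ_mean : ∀ x, ∫ ω', Z ω' x ∂P' = 0)
    (hZ_cov : ∀ x y, covariance (fun ω' => Z ω' x) (fun ω' => Z ω' y) P' =
      if x = y then σ ^ 2 / w x else 0) :
    TendstoInDistribution
      (fun (n : ℕ) (ω : Ω) => Real.sqrt n • (gStar n ω - g)) atTop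
      (fun ω' => levelwiseIsotonicRegression g w (Z ω')) (fun _ => P) P' :=
  tendstoInDistribution_isotonicRegression hg hw_pos hw hY hgStar_meas hgStar
    (tendstoInDistribution_cellSum hε_indep (fun i => hε_ident i 0) (hε_memLp 0) (hε_mean 0)
      (hε_var 0) hw_pos hw hZ hZ_mean hZ_cov)
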